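/- Let $E$ be a (real or complex) Banach space, let $(e^{tD})_{t\in\mathbb{R}}$ be a strongly continuous one-parameter group of linear isometries of $E$, and let $D$ be its infinitesimal generator, $Dx=\lim_{t\to 0}t^{-1}(e^{tD}x-x)$, defined for all $x\in E$ for which the limit exists. Let $\operatorname{sinc}x=\frac{\sin(\pi x)}{\pi x}$ for $x\neq 0$ and $\operatorname{sinc}0=1$. For $\sigma>0$ let $\mathbf{B}_\sigma(D)$ be the set of all $f\in\bigcap_{k\in\mathbb{N}}\operatorname{dom}(D^k)$ such that $\|D^kf\|\le\sigma^k\|f\|$ for all $k\in\mathbb{N}$. If $f\in\mathbf{B}_\sigma(D)$, then for every $t\in\mathbb{R}$ $$e^{tD}f=f+t\,\operatorname{sinc}\Big(\frac{\sigma t}{\pi}\Big)Df+t\sum_{k\in\mathbb{Z}\setminus\{0\}}\frac{e^{\frac{k\pi}{\sigma}D}f-f}{\frac{k\pi}{\sigma}}\operatorname{sinc}\Big(\frac{\sigma t}{\pi}-k\Big)$$ and $$f=e^{tD}f-t\,\operatorname{sinc}\Big(\frac{\sigma t}{\pi}\Big)e^{tD}Df-t\sum_{k\in\mathbb{Z}\setminus\{0\}}\frac{e^{\left(\frac{k\pi}{\sigma}+t\right)D}f-e^{tD}f}{\frac{k\pi}{\sigma}}\operatorname{sinc}\Big(\frac{\sigma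 t}{\pi}+k\Big).$$ Both series $\sum_{k\neq 0}$ (taken without the prefactor $t$) converge unconditionally in the norm of $E$, uniformly with respect to $t\in\mathbb{R}$: the net of their partial sums over finite subsets of $\mathbb{Z}\setminus\{0\}$ converges uniformly in $t\in\mathbb{R}$. -/

import Mathlib

open Filter Topology

namespace BernsteinSampling

section Sinc

/-- The normalised cardinal sine `sinc x = sin (π x) / (π x)`, `sinc 0 = 1`. -/
noncomputable def nsinc (x : ℝ) : ℝ := Real.sinc (Real.pi * x)

end Sinc

section Operators

variable {𝕜 E : Type*} [RCLike 𝕜] [NormedAddCommGroup E] [NormedSpace 𝕜 E]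

/-- Composition `A ∘ B` of partially defined operators, on its natural domain
`{x ∈ dom B | B x ∈ dom A}`. -/
noncomputable def pcomp (A B : E →ₗ.[𝕜] E) : E →ₗ.[𝕜] E where
  domain := (A.domain.comap B.toFun).map B.domain.subtype
  toFun := A.toFun.comp
    (((B.toFun.comp (Submodule.inclusion (Submodule.map_subtype_le B.domain _)))).codRestrict
      A.domain (by
        rintro ⟨x, hx⟩
        obtain ⟨y, hy, rfl⟩ := hx
        exact hy))

theorem mem_pcomp_domain {A B : E →ₗ.[𝕜] E} {x : E} :
    x ∈ (pcomp A B).domain ↔ ∃ h : x ∈ B.domain, B ⟨x, h⟩ ∈ A.domain := by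
  constructor
  · rintro ⟨y, hy, rfl⟩
    exact ⟨y.2, hy⟩
  · rintro ⟨h, h'⟩
    exact ⟨⟨x, h⟩, h', rfl⟩

theorem pcomp_apply {A B : E →ₗ.[𝕜] E} {x : E} (hx : x ∈ (pcomp A B).domain)
    (h : x ∈ B.domain) (h' : B ⟨x, h⟩ ∈ A.domain) :
    pcomp A B ⟨x, hx⟩ = A ⟨B ⟨x, h⟩, h'⟩ := rfl

/-- The powers `D ^ k` of an unbounded operator, each on its natural domain;
`D ^ 0` is the identity and `D ^ (k + 1) = D ∘ D ^ k`. -/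
noncomputable def ppow (D : E →ₗ.[𝕜] E) : ℕ → (E →ₗ.[𝕜] E)
  | 0 => LinearMap.id.toPMap ⊤
  | k + 1 => pcomp D (ppow D k)

/-- The Bernstein space `B_σ(D)`: all `f` lying in the domain of every power of `D`
with `‖D ^ k f‖ ≤ σ ^ k ‖f‖` for all `k`. -/
def bernsteinSpace (D : E →ₗ.[𝕜] E) (σ : ℝ) : Set E :=
  {f | ∀ k : ℕ, ∃ h : f ∈ (ppow D k).domain, ‖ppow D k ⟨f, h⟩‖ ≤ σ ^ k * ‖f‖}

/-- Bernstein vectors belong to the domain of `D`. -/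
theorem mem_domain_of_mem_bernsteinSpace {D : E →ₗ.[𝕜] E} {σ : ℝ} {f : E}
    (hf : f ∈ bernsteinSpace D σ) : f ∈ D.domain := by
  obtain ⟨h, -⟩ := hf 1
  obtain ⟨h0, h1⟩ := mem_pcomp_domain.1 h
  exact h1

end Operators

section Group

variable (𝕜 E : Type*) [RCLike 𝕜] [NormedAddCommGroup E] [NormedSpace 𝕜 E]

/-- A strongly continuous one-parameter group of linear isometries of `E`. -/
structure IsometryGroup where
  /-- the operator at time `t` -/
  toFun : ℝ → (E →L[𝕜] E)
  map_zero : toFun 0 = ContinuousLinearMap.id 𝕜 E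
  map_add : ∀ s t, toFun (s + t) = (toFun s).comp (toFun t)
  norm_map : ∀ t x, ‖toFun t x‖ = ‖x‖
  continuous_orbit : ∀ x, Continuous fun t => toFun t x

variable {𝕜 E}

instance : CoeFun (IsometryGroup 𝕜 E) fun _ => ℝ → (E →L[𝕜] E) := ⟨IsometryGroup.toFun⟩

namespace IsometryGroup

/-- `y` is the limit of the difference quotients `t⁻¹ (T t x - x)` as `t → 0`, `t ≠ 0`. -/
def HasGeneratorAt (T : IsometryGroup 𝕜 E) (x y : E) : Prop :=
  Tendsto (fun t : ℝ => ((t⁻¹ : ℝ) : 𝕜) • (T t x - x)) (𝓝[≠] 0) (𝓝 y)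

theorem HasGeneratorAt.add {T : IsometryGroup 𝕜 E} {x y x' y' : E}
    (h : T.HasGeneratorAt x y) (h' : T.HasGeneratorAt x' y') :
    T.HasGeneratorAt (x + x') (y + y') := by
  refine (Tendsto.add h h').congr fun t => ?_
  rw [← smul_add, _root_.map_add]
  congr 1
  abel

theorem HasGeneratorAt.smul {T : IsometryGroup 𝕜 E} {x y : E} (c : 𝕜)
    (h : T.HasGeneratorAt x y) : T.HasGeneratorAt (c • x) (c • y) := by
  refine (Tendsto.const_smul h c).congr fun t => ?_
  rw [smul_comm, _root_.map_smul, smul_sub]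

theorem HasGeneratorAt.zero (T : IsometryGroup 𝕜 E) : T.HasGeneratorAt 0 0 := by
  simp [HasGeneratorAt]

/-- The infinitesimal generator `D` of the group: `D x = lim_{t → 0} t⁻¹ (T t x - x)`, defined
on all `x` for which the limit exists in `E`. -/
noncomputable def generator (T : IsometryGroup 𝕜 E) : E →ₗ.[𝕜] E where
  domain :=
    { carrier := {x | ∃ y, T.HasGeneratorAt x y}
      add_mem' := fun ⟨_, h⟩ ⟨_, h'⟩ => ⟨_, h.add h'⟩
      zero_mem' := ⟨0, HasGeneratorAt.zero T⟩
      smul_mem' := fun c _ ⟨_, h⟩ => ⟨_, h.smul c⟩ }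
  toFun :=
    { toFun := fun x => x.2.choose
      map_add' := fun x x' => tendsto_nhds_unique (x + x').2.choose_spec
        (HasGeneratorAt.add x.2.choose_spec x'.2.choose_spec)
      map_smul' := fun c x => tendsto_nhds_unique (c • x).2.choose_spec
        (HasGeneratorAt.smul c x.2.choose_spec) }

theorem generator_spec (T : IsometryGroup 𝕜 E) (x : T.generator.domain) :
    T.HasGeneratorAt x (T.generator x) := x.2.choose_spec

/-- The `k`-th term `((e ^ ((kπ/σ) D) f - f) / (kπ/σ)) sinc (σt/π - k)` of the sampling series of
the orbit of `f`. -/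
noncomputable def samplingTerm (T : IsometryGroup 𝕜 E) (σ : ℝ) (f : E) (k : ℤ) (t : ℝ) : E :=
  ((nsinc (σ * t / Real.pi - k) : ℝ) : 𝕜) •
    ((((k * Real.pi / σ)⁻¹ : ℝ) : 𝕜) • (T (k * Real.pi / σ) f - f))

/-- The `k`-th term `((e ^ ((kπ/σ + t) D) f - e ^ (t D) f) / (kπ/σ)) sinc (σt/π + k)` of the dual
sampling series. -/
noncomputable def dualSamplingTerm (T : IsometryGroup 𝕜 E) (σ : ℝ) (f : E) (k : ℤ) (t : ℝ) : E :=
  ((nsinc (σ * t / Real.pi + k) : ℝ) : 𝕜) •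
    ((((k * Real.pi / σ)⁻¹ : ℝ) : 𝕜) • (T (k * Real.pi / σ + t) f - T t f))

end IsometryGroup

end Group

end BernsteinSampling

/-! Pair the orbit of `f` with a continuous real functional and rescale time by `σ`. The Bernstein
inequalities then say that all derivatives of the resulting scalar function share one bound `M`, so
its Taylor series defines an entire `g`. Re-expanding at `Re z` gives `|g z| ≤ M exp |Im z|`
(`norm_jetSum_zero_le`).

The quotient `u z = (g z - g 0) / z` has the same type and an extra decay `1/|z|`, enough for its
cardinal series on the points `kπ` to converge to it: the remainder divided by `sin` tends to zero
on the boundary of growing squares, and the maximum principle carries this inside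
(`norm_cardinalRemainder_le`). Multiplying by `t` gives the sampling formula for `g`, the node `0`
contributing `u 0 = g' 0`.

Convergence in norm is separate: the coefficients are `O(1/|k|)`, the squares of the shifted sincs
have uniformly bounded sums, and Cauchy–Schwarz gives unconditional uniform convergence
(`tendstoUniformly_sum_of_sq_bounds`). Since functionals separate points, the scalar identities then
identify the sum. -/

namespace BernsteinSampling

/-! ### Entire extension of a function with uniformly bounded derivatives. -/

section EntireExtension

open Nat

variable {c : ℕ → ℝ → ℂ} {M : ℝ}

/-- The derivative telescopes to its last term. Moving `s` from `0` to `t` turns the Taylor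
polynomial at `a` into `c 0 (a + t)`, so this derivative controls the Taylor remainder. -/
theorem hasDerivAt_taylorSum (hc : ∀ k x, HasDerivAt (c k) (c (k + 1) x) x) (a t : ℝ) (n : ℕ)
    (s : ℝ) :
    HasDerivAt (fun s : ℝ => ∑ k ∈ Finset.range (n + 1), ((t - s) ^ k / k ! : ℝ) • c k (a + s))
      (((t - s) ^ n / n ! : ℝ) • c (n + 1) (a + s)) s := by
  have hd (k : ℕ) : HasDerivAt (fun s : ℝ => c k (a + s)) (c (k + 1) (a + s)) s :=
    (hc k (a + s)).comp_const_add a s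
  induction n with
  | zero => simpa using hd 0
  | succ n ih =>
    simp_rw [Finset.sum_range_succ _ (n + 1)]
    have hp : HasDerivAt (fun s : ℝ => (t - s) ^ (n + 1) / ((n + 1)! : ℝ))
        (-((t - s) ^ n / (n ! : ℝ))) s := by
      refine ((((hasDerivAt_id s).const_sub t).pow (n + 1)).div_const
        ((n + 1)! : ℝ)).congr_deriv ?_
      rw [Nat.factorial_succ]
      have : (n ! : ℝ) ≠ 0 := by positivity
      push_cast
      field_simp
      simp
    refine (ih.add (hp.smul (hd (n + 1)))).congr_deriv ?_
    module

theorem hasSum_taylor (hc : ∀ k x, HasDerivAt (c k) (c (k + 1) x) x) (hb : ∀ k x, ‖c k x‖ ≤ M)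
    (a t : ℝ) : HasSum (fun k : ℕ => c k a * (t : ℂ) ^ k / (k ! : ℂ)) (c 0 (a + t)) := by
  have hM : 0 ≤ M := (norm_nonneg _).trans (hb 0 0)
  have hs : Summable fun k : ℕ => c k a * (t : ℂ) ^ k / (k ! : ℂ) := by
    refine Summable.of_norm_bounded ((Real.summable_pow_div_factorial |t|).mul_left M) fun k => ?_
    rw [norm_div, norm_mul, norm_pow, Complex.norm_real, Complex.norm_natCast, mul_div_assoc]
    exact mul_le_mul_of_nonneg_right (hb k a) (by positivity)
  refine (hs.hasSum_iff_tendsto_nat).2 ((tendsto_add_atTop_iff_nat 1).1 ?_)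
  rw [tendsto_iff_norm_sub_tendsto_zero]
  have hlim : Tendsto (fun n : ℕ => |t| ^ n / (n ! : ℝ) * M * |t|) atTop (𝓝 0) := by
    simpa using ((FloorSemiring.tendsto_pow_div_factorial_atTop |t|).mul_const M).mul_const |t|
  refine squeeze_zero (fun _ => norm_nonneg _) (fun n => ?_) hlim
  have key := (convex_uIcc (0 : ℝ) t).norm_image_sub_le_of_norm_hasDerivWithin_le
    (C := |t| ^ n / (n ! : ℝ) * M)
    (fun s _ => (hasDerivAt_taylorSum hc a t n s).hasDerivWithinAt) (fun s hs => ?_)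
    (Set.right_mem_uIcc) (Set.left_mem_uIcc)
  · have h0 : ∑ k ∈ Finset.range (n + 1), ((t - t) ^ k / k ! : ℝ) • c k (a + t) = c 0 (a + t) := by
      rw [Finset.sum_range_succ']
      simp
    rw [h0] at key
    refine le_trans (le_of_eq ?_) (key.trans_eq (by simp))
    congr 2
    refine Finset.sum_congr rfl fun k _ => ?_
    simp only [sub_zero, add_zero, Complex.real_smul]
    push_cast
    ring
  · rw [norm_smul, norm_div, norm_pow, Real.norm_eq_abs, RCLike.norm_natCast]
    have h1 : |t - s| ≤ |t| := by
      simpa using Set.abs_sub_right_of_mem_uIcc hs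
    gcongr
    exact hb _ _

/-- The sum of the Taylor series at `a` of the function whose derivatives are the `c k`. -/
noncomputable def jetSum (c : ℕ → ℝ → ℂ) (a : ℝ) (w : ℂ) : ℂ := ∑' k : ℕ, c k a * w ^ k / (k ! : ℂ)

theorem differentiable_jetSum (hb : ∀ k x, ‖c k x‖ ≤ M) (a : ℝ) :
    Differentiable ℂ (jetSum c a) := by
  intro w
  have hM : 0 ≤ M := (norm_nonneg _).trans (hb 0 0)
  have hw : Metric.ball (0 : ℂ) (‖w‖ + 1) ∈ 𝓝 w := Metric.isOpen_ball.mem_nhds (by simp)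
  refine (Complex.differentiableOn_tsum_of_summable_norm
    ((Real.summable_pow_div_factorial (‖w‖ + 1)).mul_left M)
    (fun k => ?_) Metric.isOpen_ball fun k z hz => ?_).differentiableAt hw
  · fun_prop
  · rw [norm_div, norm_mul, norm_pow, Complex.norm_natCast, mul_div_assoc]
    have : ‖z‖ ≤ ‖w‖ + 1 := by simpa using (mem_ball_zero_iff.1 hz).le
    gcongr
    exact hb k a

theorem norm_jetSum_le (hb : ∀ k x, ‖c k x‖ ≤ M) (a : ℝ) (w : ℂ) :
    ‖jetSum c a w‖ ≤ M * Real.exp ‖w‖ := by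
  have hs : HasSum (fun k : ℕ => M * (‖w‖ ^ k / (k ! : ℝ))) (M * Real.exp ‖w‖) := by
    rw [Real.exp_eq_exp_ℝ]
    exact (NormedSpace.expSeries_div_hasSum_exp ‖w‖).mul_left M
  refine tsum_of_norm_bounded hs fun k => ?_
  rw [norm_div, norm_mul, norm_pow, Complex.norm_natCast, mul_div_assoc]
  gcongr
  exact hb k a

theorem jetSum_ofReal (hc : ∀ k x, HasDerivAt (c k) (c (k + 1) x) x) (hb : ∀ k x, ‖c k x‖ ≤ M)
    (a t : ℝ) : jetSum c a t = c 0 (a + t) := (hasSum_taylor hc hb a t).tsum_eq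

/-- Both sides are entire in `w` and agree for real `w`, so the identity theorem applies. -/
theorem jetSum_add (hc : ∀ k x, HasDerivAt (c k) (c (k + 1) x) x) (hb : ∀ k x, ‖c k x‖ ≤ M)
    (a : ℝ) (w : ℂ) : jetSum c 0 (a + w) = jetSum c a w := by
  have h1 : AnalyticOnNhd ℂ (fun w : ℂ => jetSum c 0 (a + w)) Set.univ :=
    ((differentiable_jetSum hb 0).comp (differentiable_id.const_add _)).differentiableOn.analyticOnNhd
      isOpen_univ
  have h2 : AnalyticOnNhd ℂ (jetSum c a) Set.univ :=
    (differentiable_jetSum hb a).differentiableOn.analyticOnNhd isOpen_univ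
  refine congrFun (h1.eq_of_frequently_eq (z₀ := 0) h2 ?_) w
  have ht : Tendsto (fun t : ℝ => (t : ℂ)) (𝓝[≠] 0) (𝓝[≠] 0) := by
    refine tendsto_nhdsWithin_iff.2 ⟨?_, ?_⟩
    · exact (Complex.continuous_ofReal.tendsto' 0 0 (by simp)).mono_left nhdsWithin_le_nhds
    · filter_upwards [self_mem_nhdsWithin] with t ht
      simpa using ht
  refine ht.frequently (Eventually.frequently (Eventually.of_forall fun t => ?_))
  rw [← Complex.ofReal_add, jetSum_ofReal hc hb, jetSum_ofReal hc hb, zero_add]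

/-- Expanding about `z.re` leaves a purely imaginary increment, so only `|z.im|` enters the
exponential. -/
theorem norm_jetSum_zero_le (hc : ∀ k x, HasDerivAt (c k) (c (k + 1) x) x)
    (hb : ∀ k x, ‖c k x‖ ≤ M) (z : ℂ) : ‖jetSum c 0 z‖ ≤ M * Real.exp |z.im| := by
  have := norm_jetSum_le hb z.re (z.im * Complex.I)
  rwa [← jetSum_add hc hb, Complex.re_add_im, norm_mul, Complex.norm_I, mul_one,
    Complex.norm_real] at this

end EntireExtension

end BernsteinSampling

namespace BernsteinSampling

/-! ### Cardinal series by the maximum principle on squares. -/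

section CardinalSeries

open Complex

/-- The entire function `sin z / z`. -/
noncomputable def csinc : ℂ → ℂ := dslope Complex.sin 0

theorem csinc_zero : csinc 0 = 1 := by simp [csinc]

theorem mul_csinc (z : ℂ) : z * csinc z = sin z := by
  simpa [csinc] using sub_smul_dslope sin 0 z

theorem differentiable_dslope {f : ℂ → ℂ} (hf : Differentiable ℂ f) (a : ℂ) :
    Differentiable ℂ (dslope f a) :=
  differentiableOn_univ.1 ((Complex.differentiableOn_dslope univ_mem).2 hf.differentiableOn)

theorem differentiable_csinc : Differentiable ℂ csinc := differentiable_dslope differentiable_sin 0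

theorem csinc_int_mul_pi {m : ℤ} (hm : m ≠ 0) : csinc (m * Real.pi) = 0 := by
  have h := mul_csinc (m * Real.pi)
  rw [sin_int_mul_pi] at h
  refine (mul_eq_zero.1 h).resolve_left ?_
  simp [hm, Real.pi_ne_zero]

theorem csinc_ofReal (x : ℝ) : csinc x = (Real.sinc x : ℂ) := by
  rcases eq_or_ne x 0 with rfl | hx
  · simp [csinc_zero]
  · have h := mul_csinc x
    rw [Real.sinc_of_ne_zero hx, ofReal_div, ofReal_sin, eq_div_iff (by simpa using hx), ← h]
    ring

theorem norm_csinc_sub_int_mul_pi {z : ℂ} (k : ℤ) (hz : sin z ≠ 0) :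
    ‖csinc (z - k * Real.pi)‖ = ‖sin z‖ / ‖z - k * Real.pi‖ := by
  have h := mul_csinc (z - k * Real.pi)
  have h' : ‖z - k * Real.pi‖ * ‖csinc (z - k * Real.pi)‖ = ‖sin z‖ := by
    rw [← norm_mul, h, sin_antiperiodic.sub_int_mul_eq]
    simp
  have h0 : ‖z - k * Real.pi‖ ≠ 0 := by
    intro h0
    rw [h0, zero_mul, eq_comm, norm_eq_zero] at h'
    exact hz h'
  rw [← h']
  field_simp

/-- Rests on `|sin z|² = sin² (Re z) + sinh² (Im z)`. The two alternatives cover the vertical and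
the horizontal sides of the squares used below. -/
theorem exp_abs_im_le_norm_sin {z : ℂ} (h : cos (z.re : ℂ) = 0 ∨ 1 ≤ |z.im|) :
    Real.exp |z.im| ≤ 4 * ‖sin z‖ := by
  have hz : ‖sin z‖ ^ 2 = Real.sin z.re ^ 2 + Real.sinh z.im ^ 2 := by
    rw [sin_eq, ← normSq_eq_norm_sq, ← ofReal_sin, ← ofReal_cos, ← ofReal_sinh, ← ofReal_cosh,
      ← ofReal_mul, ← ofReal_mul, normSq_add_mul_I]
    have h1 := Real.cosh_sq z.im
    have h2 := Real.sin_sq_add_cos_sq z.re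
    linear_combination Real.sin z.re ^ 2 * h1 + Real.sinh z.im ^ 2 * h2
  have hs : Real.sinh z.im ^ 2 = ((Real.exp |z.im| - Real.exp (-|z.im|)) / 2) ^ 2 := by
    rw [← Real.sinh_eq]
    rcases abs_choice z.im with h | h <;> simp [h]
  have hE : Real.exp |z.im| * Real.exp (-|z.im|) = 1 := by rw [← Real.exp_add]; simp
  have hpos := Real.exp_pos (-|z.im|)
  have hE1 : 1 ≤ Real.exp |z.im| := Real.one_le_exp (abs_nonneg _)
  refine abs_le_of_sq_le_sq' (b := 4 * ‖sin z‖) ?_ (by positivity) |>.2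
  rw [mul_pow, hz, hs]
  set a := Real.exp |z.im|
  set b := Real.exp (-|z.im|)
  rcases h with h | h
  · have hc : Real.cos z.re = 0 := by exact_mod_cast h
    have : Real.sin z.re ^ 2 = 1 := by simpa [hc] using Real.sin_sq_add_cos_sq z.re
    rw [this]
    nlinarith [sq_nonneg a, sq_nonneg b]
  · have h2 : 2 ≤ a := by
      have := Real.add_one_le_exp |z.im|
      linarith
    have hb : b ≤ 1 / 2 := by nlinarith
    nlinarith [sq_nonneg (Real.sin z.re)]

/-- At a common zero the factors `z - a` cancel, leaving a quotient of `dslope`s. The value chosen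
at zeros of `s` is the one that removes the singularity. -/
theorem differentiableAt_div_of_simple_zero {K s : ℂ → ℂ} (hK : Differentiable ℂ K)
    (hs : Differentiable ℂ s) {a : ℂ} (h : s a = 0 → K a = 0 ∧ deriv s a ≠ 0) :
    DifferentiableAt ℂ (fun z => if s z = 0 then deriv K z / deriv s z else K z / s z) a := by
  by_cases h0 : s a = 0
  · obtain ⟨hKa, hsa⟩ := h h0
    have hds : DifferentiableAt ℂ (dslope s a) a := differentiable_dslope hs a a
    have hne : dslope s a a ≠ 0 := by rwa [dslope_same]
    refine ((differentiable_dslope hK a a).div hds hne).congr_of_eventuallyEq ?_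
    filter_upwards [hds.continuousAt.eventually_ne hne] with z hz
    rcases eq_or_ne z a with rfl | hza
    · simp [h0]
    · have e1 := sub_smul_dslope s a z
      have e2 := sub_smul_dslope K a z
      rw [h0, sub_zero, smul_eq_mul] at e1
      rw [hKa, sub_zero, smul_eq_mul] at e2
      have hza' := sub_ne_zero.2 hza
      have : s z ≠ 0 := by rw [← e1]; exact mul_ne_zero hza' hz
      rw [if_neg this, ← e1, ← e2, mul_div_mul_left _ _ hza']
      rfl
  · refine ((hK a).div (hs a) h0).congr_of_eventuallyEq ?_
    filter_upwards [(hs a).continuousAt.eventually_ne h0] with z hz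
    simp [hz]

/-- The difference between `u` and the symmetric partial sum of its cardinal series. -/
noncomputable def cardinalRemainder (u : ℂ → ℂ) (N : ℕ) (z : ℂ) : ℂ :=
  u z - ∑ k ∈ Finset.Icc (-N : ℤ) N, u (k * Real.pi) * csinc (z - k * Real.pi)

variable {u : ℂ → ℂ} {C : ℝ}

theorem differentiable_cardinalRemainder (hu : Differentiable ℂ u) (N : ℕ) :
    Differentiable ℂ (cardinalRemainder u N) := by
  refine hu.sub (Differentiable.fun_sum fun k _ => ?_)
  exact (differentiable_csinc.comp (differentiable_id.sub_const _)).const_mul _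

theorem cardinalRemainder_int_mul_pi {N : ℕ} {j : ℤ} (hj : j ∈ Finset.Icc (-N : ℤ) N) :
    cardinalRemainder u N (j * Real.pi) = 0 := by
  rw [cardinalRemainder, Finset.sum_eq_single_of_mem j hj]
  · simp [csinc_zero]
  · intro k _ hk
    rw [← sub_mul, ← Int.cast_sub, csinc_int_mul_pi (sub_ne_zero.2 hk.symm), mul_zero]

/-- A bound for the remainder of the cardinal series divided by the sine, on a large square. -/
noncomputable def cardinalBound (N : ℕ) : ℝ :=
  4 / (N + 1) + 4 * (((N + 1 : ℕ) : ℝ)⁻¹ * ∑ n ∈ Finset.range (N + 1), 1 / ((n : ℝ) + 1))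

/-- The second summand is a Cesàro mean of the null sequence `1 / (n + 1)`. -/
theorem tendsto_cardinalBound : Tendsto cardinalBound atTop (𝓝 0) := by
  have h1 : Tendsto (fun N : ℕ => 4 / ((N : ℝ) + 1)) atTop (𝓝 0) := by
    simpa [div_eq_mul_inv] using
      (tendsto_one_div_add_atTop_nhds_zero_nat (𝕜 := ℝ)).const_mul 4
  have h2 := ((tendsto_add_atTop_iff_nat 1).2
    (tendsto_one_div_add_atTop_nhds_zero_nat (𝕜 := ℝ)).cesaro).const_mul 4
  have h3 := h1.add h2
  rwa [mul_zero, add_zero] at h3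

/-- Partial fractions give the factor `1 / (N + 2)`, relaxed to `1 / (N + 1)`. The `4` is a `2` from
the symmetry `k ↦ -k` times a `2` from the reflection `n ↦ N - n`. -/
theorem sum_inv_mul_inv_le (N : ℕ) :
    ∑ k ∈ Finset.Icc (-N : ℤ) N, 1 / ((1 + |(k : ℝ)|) * (N + 1 - |(k : ℝ)|)) ≤
      4 * (((N + 1 : ℕ) : ℝ)⁻¹ * ∑ n ∈ Finset.range (N + 1), 1 / ((n : ℝ) + 1)) := by
  have heven : Function.Even
      (fun k : ℤ => 1 / ((1 + |(k : ℝ)|) * (N + 1 - |(k : ℝ)|))) := by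
    intro k
    simp
  rw [Finset.sum_Icc_of_even_eq_range heven]
  have hrefl := Finset.sum_range_reflect (fun n : ℕ => 1 / ((n : ℝ) + 1)) (N + 1)
  have hterm : ∀ n ∈ Finset.range (N + 1),
      1 / ((1 + |((n : ℤ) : ℝ)|) * (N + 1 - |((n : ℤ) : ℝ)|)) ≤
        ((N + 1 : ℕ) : ℝ)⁻¹ * (1 / ((n : ℝ) + 1) + 1 / (((N + 1 - 1 - n : ℕ) : ℝ) + 1)) := by
    intro n hn
    have hn' : n ≤ N := Nat.lt_succ_iff.1 (Finset.mem_range.1 hn)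
    have hnR : (n : ℝ) ≤ N := by exact_mod_cast hn'
    rw [Nat.add_sub_cancel, Nat.cast_sub hn', Int.cast_natCast, Nat.abs_cast]
    have h1 : (0 : ℝ) < n + 1 := by positivity
    have h2 : (0 : ℝ) < N - n + 1 := by linarith
    rw [div_add_div _ _ h1.ne' h2.ne', ← div_eq_inv_mul, div_div, div_le_div_iff₀
      (mul_pos (by linarith) (by linarith)) (by positivity)]
    push_cast
    nlinarith [mul_pos h1 h2]
  have hsum := Finset.sum_le_sum hterm
  rw [← Finset.mul_sum, Finset.sum_add_distrib, hrefl] at hsum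
  have h0 : (0 : ℝ) ≤ 1 / ((1 + |((0 : ℤ) : ℝ)|) * (N + 1 - |((0 : ℤ) : ℝ)|)) := by
    simp only [Int.cast_zero, abs_zero, sub_zero]
    positivity
  rw [two_nsmul]
  linarith

theorem norm_cardinalRemainder_div_sin_le (h : ∀ z, ‖u z‖ * (1 + ‖z‖) ≤ C * Real.exp |z.im|)
    {N : ℕ} {z : ℂ} (hz : Real.exp |z.im| ≤ 4 * ‖sin z‖) (hN : N ≤ ‖z‖)
    (hd : ∀ k ∈ Finset.Icc (-N : ℤ) N, N + 1 - |(k : ℝ)| ≤ ‖z - k * Real.pi‖) :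
    ‖cardinalRemainder u N z / sin z‖ ≤ C * cardinalBound N := by
  have hs : 0 < ‖sin z‖ := by
    have := Real.exp_pos |z.im|
    linarith
  have hC : 0 ≤ C := by
    have := (by positivity : 0 ≤ ‖u 0‖ * (1 + ‖(0 : ℂ)‖)).trans (h 0)
    simpa using this
  have hsum : ∀ k ∈ Finset.Icc (-N : ℤ) N,
      ‖u (k * Real.pi) * csinc (z - k * Real.pi)‖ ≤
        ‖sin z‖ * C * (1 / ((1 + |(k : ℝ)|) * (N + 1 - |(k : ℝ)|))) := by
    intro k hk
    have hkN : |(k : ℝ)| ≤ N := by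
      rw [Finset.mem_Icc] at hk
      exact abs_le.2 ⟨by exact_mod_cast hk.1, by exact_mod_cast hk.2⟩
    have hp : 0 < (N : ℝ) + 1 - |(k : ℝ)| := by linarith
    have hu : ‖u (k * Real.pi)‖ ≤ C / (1 + |(k : ℝ)|) := by
      rw [le_div_iff₀ (by positivity)]
      have h1 := h (k * Real.pi)
      have h2 : ((k : ℂ) * Real.pi).im = 0 := by simp
      rw [h2, abs_zero, Real.exp_zero, mul_one] at h1
      refine le_trans (mul_le_mul_of_nonneg_left ?_ (norm_nonneg _)) h1
      rw [norm_mul, norm_real, norm_intCast, Real.norm_of_nonneg Real.pi_pos.le]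
      have := Real.pi_gt_three
      nlinarith [abs_nonneg (k : ℝ)]
    rw [norm_mul, norm_csinc_sub_int_mul_pi k (norm_pos_iff.1 hs)]
    calc _ ≤ C / (1 + |(k : ℝ)|) * (‖sin z‖ / (N + 1 - |(k : ℝ)|)) := by
          gcongr
          exact hd k hk
      _ = _ := by field_simp
  have hu : ‖u z‖ ≤ ‖sin z‖ * C * (4 / (N + 1)) := by
    rw [← mul_div_assoc, le_div_iff₀ (by positivity)]
    calc ‖u z‖ * (N + 1) ≤ ‖u z‖ * (1 + ‖z‖) := mul_le_mul_of_nonneg_left (by linarith) (norm_nonneg _)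
      _ ≤ C * Real.exp |z.im| := h z
      _ ≤ C * (4 * ‖sin z‖) := by gcongr
      _ = _ := by ring
  rw [norm_div, div_le_iff₀ hs]
  refine (norm_sub_le _ _).trans ((add_le_add hu ((norm_sum_le _ _).trans
    (Finset.sum_le_sum hsum))).trans ?_)
  rw [← Finset.mul_sum]
  calc _ ≤ ‖sin z‖ * C * (4 / (N + 1)) + ‖sin z‖ * C *
        (4 * (((N + 1 : ℕ) : ℝ)⁻¹ * ∑ n ∈ Finset.range (N + 1), 1 / ((n : ℝ) + 1))) := by
        gcongr
        exact sum_inv_mul_inv_le N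
    _ = _ := by rw [cardinalBound]; ring

theorem norm_cardinalRemainder_le (hu : Differentiable ℂ u)
    (h : ∀ z, ‖u z‖ * (1 + ‖z‖) ≤ C * Real.exp |z.im|) {N : ℕ} {t : ℝ} (ht : |t| ≤ N) :
    ‖cardinalRemainder u N t‖ ≤ C * cardinalBound N * ‖sin t‖ := by
  -- The vertical sides lie midway between zeros of `sin`, where `cos` vanishes, and the only zeros
  -- with `|Re z| ≤ R` are the nodes `kπ` with `|k| ≤ N`, where the remainder vanishes too.
  set R : ℝ := (N + 1 / 2) * Real.pi with hR
  have hpi := Real.pi_gt_three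
  have hNR : (N : ℝ) + 1 ≤ R := by nlinarith [(Nat.cast_nonneg N : (0 : ℝ) ≤ N)]
  have hR0 : -R < R := by linarith [(Nat.cast_nonneg N : (0 : ℝ) ≤ N)]
  set H : ℂ → ℂ := fun z => if sin z = 0 then
    deriv (cardinalRemainder u N) z / deriv sin z else cardinalRemainder u N z / sin z with hH
  have hcl : closure (Set.Ioo (-R) R ×ℂ Set.Ioo (-R) R) = Set.Icc (-R) R ×ℂ Set.Icc (-R) R := by
    rw [closure_reProdIm, closure_Ioo hR0.ne]
  have hzero : ∀ z : ℂ, |z.re| ≤ R → sin z = 0 →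
      cardinalRemainder u N z = 0 ∧ deriv sin z ≠ 0 := by
    intro z hz hsz
    constructor
    · obtain ⟨j, rfl⟩ := sin_eq_zero_iff.1 hsz
      apply cardinalRemainder_int_mul_pi
      have hre : ((j : ℂ) * Real.pi).re = j * Real.pi := by simp
      rw [hre, abs_mul, abs_of_pos Real.pi_pos] at hz
      have hj : |(j : ℝ)| < N + 1 := by
        have := le_of_mul_le_mul_right hz Real.pi_pos
        linarith
      have hj' : |j| < N + 1 := by exact_mod_cast hj
      rw [Finset.mem_Icc, ← abs_le]
      omega
    · intro hc
      have h1 := sin_sq_add_cos_sq z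
      rw [Complex.deriv_sin] at hc
      simp [hsz, hc] at h1
  have hdiff : DiffContOnCl ℂ H (Set.Ioo (-R) R ×ℂ Set.Ioo (-R) R) := by
    refine DifferentiableOn.diffContOnCl ?_
    rw [hcl]
    intro z hz
    exact (differentiableAt_div_of_simple_zero (differentiable_cardinalRemainder hu N)
      differentiable_sin (hzero z (abs_le.2 hz.1))).differentiableWithinAt
  have hbound : ∀ z ∈ frontier (Set.Ioo (-R) R ×ℂ Set.Ioo (-R) R),
      ‖H z‖ ≤ C * cardinalBound N := by
    intro z hz
    rw [frontier_reProdIm, closure_Ioo hR0.ne, frontier_Ioo hR0] at hz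
    have hz' : |z.re| = R ∨ |z.im| = R := by
      have habs : ∀ x : ℝ, x = -R ∨ x = R → |x| = R := by
        rintro x (rfl | rfl)
        · rw [abs_neg, abs_of_pos (by linarith)]
        · rw [abs_of_pos (by linarith)]
      rcases hz with hz | hz
      · exact Or.inr (habs _ hz.2)
      · exact Or.inl (habs _ hz.1)
    have hexp : Real.exp |z.im| ≤ 4 * ‖sin z‖ := by
      refine exp_abs_im_le_norm_sin (hz'.imp (fun h => ?_) fun h => ?_)
      · rw [← ofReal_cos, ← Real.cos_abs, h, ofReal_eq_zero, Real.cos_eq_zero_iff]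
        exact ⟨N, by rw [hR]; push_cast; ring⟩
      · rw [h]
        linarith [(Nat.cast_nonneg N : (0 : ℝ) ≤ N)]
    have hs : sin z ≠ 0 := by
      intro hs
      rw [hs, norm_zero, mul_zero] at hexp
      exact absurd (Real.exp_pos |z.im|) hexp.not_gt
    have hnorm : R ≤ ‖z‖ := by
      rcases hz' with h | h
      · exact h ▸ abs_re_le_norm z
      · exact h ▸ abs_im_le_norm z
    simp only [hH, if_neg hs]
    refine norm_cardinalRemainder_div_sin_le h hexp (by linarith) fun k hk => ?_
    have hkN : |(k : ℝ)| ≤ N := by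
      rw [Finset.mem_Icc] at hk
      exact abs_le.2 ⟨by exact_mod_cast hk.1, by exact_mod_cast hk.2⟩
    rcases hz' with h | h
    · refine le_trans ?_ (abs_re_le_norm _)
      have h1 : (z - k * Real.pi).re = z.re - k * Real.pi := by simp
      have h2 := abs_sub_abs_le_abs_sub z.re (k * Real.pi)
      rw [h1]
      refine le_trans ?_ h2
      -- With `m = N - |k| ≥ 0` this is `m + 1 ≤ (m + 1/2)π`, true because `π > 2`.
      rw [h, abs_mul, abs_of_pos Real.pi_pos, hR]
      nlinarith
    · refine le_trans ?_ (abs_im_le_norm _)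
      have h1 : (z - k * Real.pi).im = z.im := by simp
      rw [h1, h]
      linarith [abs_nonneg (k : ℝ)]
  have hmem : (t : ℂ) ∈ closure (Set.Ioo (-R) R ×ℂ Set.Ioo (-R) R) := by
    rw [hcl]
    constructor
    · exact abs_le.1 (by simpa using ht.trans (by linarith))
    · simpa using (by linarith : 0 ≤ R)
  have hHt := Complex.norm_le_of_forall_mem_frontier_norm_le
    ((Metric.isBounded_Ioo _ _).reProdIm (Metric.isBounded_Ioo _ _)) hdiff hbound hmem
  by_cases hs : sin (t : ℂ) = 0
  · rw [(hzero t (by simpa using ht.trans (by linarith)) hs).1, hs]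
    simp
  · simp only [hH, if_neg hs, norm_div] at hHt
    rwa [div_le_iff₀ (norm_pos_iff.2 hs)] at hHt

/-- The cardinal series of an entire function of exponential type one with decay `1 / |z|`. -/
theorem tendsto_cardinalSeries (hu : Differentiable ℂ u)
    (h : ∀ z, ‖u z‖ * (1 + ‖z‖) ≤ C * Real.exp |z.im|) (t : ℝ) :
    Tendsto (fun N : ℕ => ∑ k ∈ Finset.Icc (-N : ℤ) N,
      u (k * Real.pi) * csinc (t - k * Real.pi)) atTop (𝓝 (u t)) := by
  rw [tendsto_iff_norm_sub_tendsto_zero]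
  have hlim : Tendsto (fun N => C * cardinalBound N * ‖sin (t : ℂ)‖) atTop (𝓝 0) := by
    simpa using (tendsto_cardinalBound.const_mul C).mul_const ‖sin (t : ℂ)‖
  refine squeeze_zero' (Eventually.of_forall fun _ => norm_nonneg _) ?_ hlim
  filter_upwards [tendsto_natCast_atTop_atTop.eventually_ge_atTop |t|] with N hN
  rw [norm_sub_rev]
  exact norm_cardinalRemainder_le hu h hN

end CardinalSeries

end BernsteinSampling

namespace BernsteinSampling

/-! ### Uniform unconditional convergence by Cauchy–Schwarz. -/

section UniformConvergence

theorem sinc_sq_le {x y : ℝ} (hx : x ≠ 0) (h : |x| ≤ |y|) : Real.sinc y ^ 2 ≤ 1 / x ^ 2 := by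
  have hx' : 0 < |x| := abs_pos.2 hx
  have hy : y ≠ 0 := abs_pos.1 (hx'.trans_le h)
  rw [Real.sinc_of_ne_zero hy, div_pow]
  exact div_le_div₀ zero_le_one (Real.sin_sq_le_one y) (by positivity) (sq_le_sq.2 h)

/-- Let `n` be the integer nearest to `x / π`. For `k ≠ n`, `|x - kπ| ≥ |k - n|π - π/2 ≥ |k - n|`;
the term `k = n` is at most `1`. -/
theorem sum_sinc_sub_int_mul_pi_sq_le (x : ℝ) (s : Finset ℤ) :
    ∑ k ∈ s, Real.sinc (x - k * Real.pi) ^ 2 ≤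
      ∑' m : ℤ, ((if m = 0 then 1 else 0) + 1 / (m : ℝ) ^ 2) := by
  set B : ℤ → ℝ := fun m => (if m = 0 then 1 else 0) + 1 / (m : ℝ) ^ 2 with hB
  have hBs : Summable B := by
    refine Summable.add ?_ (Real.summable_one_div_int_pow.2 one_lt_two)
    exact summable_of_ne_finset_zero (s := {0}) fun m hm => if_neg (by simpa using hm)
  have hB0 : ∀ m, 0 ≤ B m := fun m => by simp only [hB]; positivity
  have hpi := Real.pi_gt_three
  set n := round (x / Real.pi) with hn
  have hr : |x - n * Real.pi| ≤ Real.pi / 2 := by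
    have h1 := abs_sub_round (x / Real.pi)
    have h2 : x - n * Real.pi = (x / Real.pi - round (x / Real.pi)) * Real.pi := by
      rw [sub_mul, div_mul_cancel₀ _ Real.pi_ne_zero]
    rw [h2, abs_mul, abs_of_pos Real.pi_pos]
    nlinarith
  have hterm : ∀ k : ℤ, Real.sinc (x - k * Real.pi) ^ 2 ≤ B (k - n) := by
    intro k
    by_cases hk : k - n = 0
    · have : Real.sinc (x - k * Real.pi) ^ 2 ≤ 1 := by
        rw [← sq_abs]
        exact pow_le_one₀ (abs_nonneg _) (Real.abs_sinc_le_one _)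
      simpa [hB, hk] using this
    · simp only [hB, if_neg hk, zero_add]
      refine sinc_sq_le (by exact_mod_cast hk) ?_
      have h1 : (1 : ℝ) ≤ |((k - n : ℤ) : ℝ)| := by exact_mod_cast Int.one_le_abs hk
      have h2 : x - k * Real.pi = (x - n * Real.pi) - ((k - n : ℤ) : ℝ) * Real.pi := by
        push_cast
        ring
      have h3 := abs_sub_abs_le_abs_sub (((k - n : ℤ) : ℝ) * Real.pi) (x - n * Real.pi)
      rw [h2, abs_sub_comm]
      refine le_trans ?_ h3
      rw [abs_mul, abs_of_pos Real.pi_pos]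
      nlinarith
  calc _ ≤ ∑ k ∈ s, B (k - n) := Finset.sum_le_sum fun k _ => hterm k
    _ ≤ ∑' k, B (k - n) :=
        Summable.sum_le_tsum s (fun k _ => hB0 _) ((Equiv.subRight n).summable_iff.2 hBs)
    _ = ∑' m, B m := (Equiv.subRight n).tsum_eq B

variable {ι α E : Type*} [NormedAddCommGroup E] [CompleteSpace E]

/-- A series dominated by products of a square summable sequence with uniformly square summable
functions converges unconditionally and uniformly. -/
theorem tendstoUniformly_sum_of_sq_bounds {F : ι → α → E} {A : ι → ℝ} {S : ι → α → ℝ} {C : ℝ}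
    (hF : ∀ i x, ‖F i x‖ ≤ A i * S i x) (hA : Summable fun i => A i ^ 2)
    (hS : ∀ (s : Finset ι) x, ∑ i ∈ s, S i x ^ 2 ≤ C) :
    (∀ x, Summable fun i => F i x) ∧
      TendstoUniformly (fun (s : Finset ι) x => ∑ i ∈ s, F i x) (fun x => ∑' i, F i x) atTop := by
  classical
  rcases isEmpty_or_nonempty α with hα | ⟨⟨x₀⟩⟩
  · exact ⟨fun x => hα.elim x, fun u hu => Eventually.of_forall fun s x => hα.elim x⟩
  have hC : 0 ≤ C := by simpa using hS ∅ x₀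
  have key : ∀ ε > 0, ∃ s : Finset ι, ∀ t, Disjoint t s → ∀ x, ‖∑ i ∈ t, F i x‖ < ε := by
    intro ε hε
    -- Cauchy–Schwarz multiplies this tail by `C`; dividing by `C + 1` also covers `C = 0`.
    obtain ⟨s, hs⟩ := summable_iff_vanishing_norm.1 hA (ε ^ 2 / (C + 1)) (by positivity)
    refine ⟨s, fun t ht x => ?_⟩
    have h1 := (le_abs_self _).trans_lt (hs t ht)
    have h2 := Finset.sum_mul_sq_le_sq_mul_sq t A (fun i => S i x)
    have h3 : ‖∑ i ∈ t, F i x‖ ≤ ∑ i ∈ t, A i * S i x :=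
      (norm_sum_le _ _).trans (Finset.sum_le_sum fun i _ => hF i x)
    have h4 : (∑ i ∈ t, A i * S i x) ^ 2 < ε ^ 2 := by
      rw [lt_div_iff₀ (by positivity)] at h1
      have h5 : 0 ≤ ∑ i ∈ t, A i ^ 2 := Finset.sum_nonneg fun i _ => sq_nonneg _
      nlinarith [mul_le_mul_of_nonneg_left (hS t x) h5]
    exact h3.trans_lt (abs_lt_of_sq_lt_sq h4 hε.le |> lt_of_le_of_lt (le_abs_self _))
  have hsum : ∀ x, Summable fun i => F i x := fun x =>
    summable_iff_vanishing_norm.2 fun ε hε =>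
      (key ε hε).imp fun s hs t ht => hs t ht x
  refine ⟨hsum, Metric.tendstoUniformly_iff.2 fun ε hε => ?_⟩
  obtain ⟨s₀, hs₀⟩ := key (ε / 2) (half_pos hε)
  filter_upwards [eventually_ge_atTop s₀] with s hs x
  have hlim : Tendsto (fun t : Finset ι => ‖∑ i ∈ t, F i x - ∑ i ∈ s, F i x‖) atTop
      (𝓝 ‖∑' i, F i x - ∑ i ∈ s, F i x‖) := ((hsum x).hasSum.sub_const _).norm
  rw [dist_eq_norm]
  refine (le_of_tendsto hlim ?_).trans_lt (half_lt_self hε)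
  filter_upwards [eventually_ge_atTop s] with t ht
  rw [← Finset.sum_sdiff ht, add_sub_cancel_right]
  exact (hs₀ _ (Finset.disjoint_of_subset_right hs Finset.sdiff_disjoint) x).le

end UniformConvergence

/-! ### Sampling formula for scalar and vector-valued functions. -/

section SamplingSeries

/-- Compactness handles the unit disc. Outside it, `1 + |z| ≤ 2|z|` and `|g z - g 0| ≤ 2M exp |Im
z|`, whence `4M`. -/
theorem exists_norm_dslope_jetSum_le {c : ℕ → ℝ → ℂ} {M : ℝ}
    (hc : ∀ k x, HasDerivAt (c k) (c (k + 1) x) x) (hb : ∀ k x, ‖c k x‖ ≤ M) :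
    ∃ C, ∀ z, ‖dslope (jetSum c 0) 0 z‖ * (1 + ‖z‖) ≤ C * Real.exp |z.im| := by
  have hM : 0 ≤ M := (norm_nonneg _).trans (hb 0 0)
  obtain ⟨B, hB⟩ := (isCompact_closedBall (0 : ℂ) 1).exists_bound_of_continuousOn
    (differentiable_dslope (differentiable_jetSum hb 0) 0).continuous.continuousOn
  have hB0 : 0 ≤ B := (norm_nonneg _).trans (hB 0 (by simp))
  refine ⟨2 * B + 4 * M, fun z => ?_⟩
  have hE : 1 ≤ Real.exp |z.im| := Real.one_le_exp (abs_nonneg _)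
  rcases le_total ‖z‖ 1 with hz | hz
  · have h1 := hB z (by simpa using hz)
    nlinarith [norm_nonneg (dslope (jetSum c 0) 0 z), norm_nonneg z, mul_nonneg hM (zero_le_one.trans hE)]
  · have h1 : ‖z‖ * ‖dslope (jetSum c 0) 0 z‖ ≤ 2 * M * Real.exp |z.im| := by
      have h2 := sub_smul_dslope (jetSum c 0) 0 z
      rw [sub_zero, smul_eq_mul] at h2
      rw [← norm_mul, h2]
      refine (norm_sub_le _ _).trans ?_
      have h3 := norm_jetSum_zero_le hc hb z
      have h4 := norm_jetSum_zero_le hc hb 0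
      simp only [Complex.zero_im, abs_zero, Real.exp_zero, mul_one] at h4
      nlinarith
    nlinarith [norm_nonneg (dslope (jetSum c 0) 0 z), mul_nonneg hB0 (zero_le_one.trans hE)]

theorem deriv_jetSum_zero {c : ℕ → ℝ → ℂ} {M : ℝ}
    (hc : ∀ k x, HasDerivAt (c k) (c (k + 1) x) x) (hb : ∀ k x, ‖c k x‖ ≤ M) :
    deriv (jetSum c 0) 0 = c 1 0 := by
  have h1 : HasDerivAt (jetSum c 0) (deriv (jetSum c 0) 0) ((0 : ℝ) : ℂ) := by
    simpa using (differentiable_jetSum hb 0 0).hasDerivAt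
  refine h1.comp_ofReal.unique ((hc 0 0).congr_of_eventuallyEq (Eventually.of_forall fun t => ?_))
  simp [jetSum_ofReal hc hb]

theorem tendsto_sampling_real {c : ℕ → ℝ → ℝ} {M : ℝ}
    (hc : ∀ k x, HasDerivAt (c k) (c (k + 1) x) x) (hb : ∀ k x, |c k x| ≤ M) (t : ℝ) :
    Tendsto (fun N : ℕ => t * Real.sinc t * c 1 0 + t * ∑ k ∈ (Finset.Icc (-N : ℤ) N).erase 0,
      Real.sinc (t - k * Real.pi) * ((k * Real.pi)⁻¹ * (c 0 (k * Real.pi) - c 0 0)))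
      atTop (𝓝 (c 0 t - c 0 0)) := by
  set d : ℕ → ℝ → ℂ := fun k x => (c k x : ℂ) with hd
  have hdc : ∀ k x, HasDerivAt (d k) (d (k + 1) x) x := fun k x => (hc k x).ofReal_comp
  have hdb : ∀ k x, ‖d k x‖ ≤ M := fun k x => by simpa [hd] using hb k x
  obtain ⟨C, hC⟩ := exists_norm_dslope_jetSum_le hdc hdb
  have hlim := (tendsto_cardinalSeries (differentiable_dslope (differentiable_jetSum hdb 0) 0)
    hC t).const_mul (t : ℂ)
  have hg : ∀ x : ℝ, jetSum d 0 x = c 0 x := fun x => by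
    rw [jetSum_ofReal hdc hdb, zero_add]
  have h0 : jetSum d 0 0 = c 0 0 := by simpa using hg 0
  have ht : (t : ℂ) * dslope (jetSum d 0) 0 t = ((c 0 t - c 0 0 : ℝ) : ℂ) := by
    have := sub_smul_dslope (jetSum d 0) 0 (t : ℂ)
    rw [sub_zero, smul_eq_mul, hg, h0] at this
    rw [this, Complex.ofReal_sub]
  rw [ht] at hlim
  have hre := (Complex.continuous_re.tendsto _).comp hlim
  rw [Complex.ofReal_re] at hre
  refine hre.congr fun N => ?_
  have hterm : ∀ k ∈ (Finset.Icc (-N : ℤ) N).erase 0,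
      dslope (jetSum d 0) 0 (k * Real.pi) * csinc (t - k * Real.pi) =
        ((Real.sinc (t - k * Real.pi) *
          ((k * Real.pi)⁻¹ * (c 0 (k * Real.pi) - c 0 0)) : ℝ) : ℂ) := by
    intro k hk
    have hk0 : (k : ℂ) * Real.pi ≠ 0 := by
      simpa [Real.pi_ne_zero] using (Finset.mem_erase.1 hk).1
    have h1 := hg (k * Real.pi)
    have h2 := csinc_ofReal (t - k * Real.pi)
    push_cast at h1 h2
    rw [dslope_of_ne _ hk0, slope_def_field, h1, h0, h2]
    push_cast
    rw [sub_zero]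
    field_simp
  rw [Function.comp_apply, ← Finset.add_sum_erase _ _ (show (0 : ℤ) ∈ Finset.Icc (-N : ℤ) N by simp),
    Finset.sum_congr rfl hterm]
  simp only [Int.cast_zero, zero_mul, sub_zero, dslope_same, deriv_jetSum_zero hdc hdb,
    csinc_ofReal]
  rw [← Complex.ofReal_sum, show d 1 0 = (c 1 0 : ℂ) from rfl, ← Complex.ofReal_mul, ← Complex.ofReal_add, ← Complex.ofReal_mul,
    Complex.ofReal_re]
  ring

variable {E : Type*} [NormedAddCommGroup E] [NormedSpace ℝ E]

theorem tendsto_Icc_subtype_ne_zero :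
    Tendsto (fun N : ℕ => (Finset.Icc (-N : ℤ) N).subtype (· ≠ 0)) atTop atTop := by
  refine tendsto_atTop_finset_of_monotone (fun m n hmn k hk => ?_) fun k => ⟨k.1.natAbs, ?_⟩
  · simp only [Finset.mem_subtype, Finset.mem_Icc] at hk ⊢
    omega
  · simp only [Finset.mem_subtype, Finset.mem_Icc]
    omega

/-- With summability given, the unconditional sum is also the limit along symmetric intervals, which
is what the scalar formula computes after applying a functional. -/
theorem eq_add_tsum_sampling {v : ℕ → ℝ → E} {B σ : ℝ} (hσ : 0 < σ)
    (hv : ∀ k x, HasDerivAt (v k) (v (k + 1) x) x) (hb : ∀ k x, ‖v k x‖ ≤ σ ^ k * B) (t : ℝ)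
    (hs : Summable fun k : {k : ℤ // k ≠ 0} => nsinc (σ * t / Real.pi - (k : ℤ)) •
      ((k : ℤ) * Real.pi / σ)⁻¹ • (v 0 ((k : ℤ) * Real.pi / σ) - v 0 0)) :
    v 0 t = v 0 0 + (t * nsinc (σ * t / Real.pi)) • v 1 0 +
      t • ∑' k : {k : ℤ // k ≠ 0}, nsinc (σ * t / Real.pi - (k : ℤ)) •
        ((k : ℤ) * Real.pi / σ)⁻¹ • (v 0 ((k : ℤ) * Real.pi / σ) - v 0 0) := by
  have hpi := Real.pi_ne_zero
  have hsinc : ∀ k : ℤ, nsinc (σ * t / Real.pi - k) = Real.sinc (σ * t - k * Real.pi) := by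
    intro k
    rw [nsinc]
    congr 1
    field_simp
  have hsinc0 : nsinc (σ * t / Real.pi) = Real.sinc (σ * t) := by simpa using hsinc 0
  rw [SeparatingDual.eq_iff_forall_dual_eq (R := ℝ)]
  intro φ
  -- Rescaling time by `σ` normalises the exponential type to one and makes the bound independent of
  -- `k`.
  set c : ℕ → ℝ → ℝ := fun k x => (σ ^ k)⁻¹ * φ (v k (x / σ)) with hc
  have hcd : ∀ k x, HasDerivAt (c k) (c (k + 1) x) x := by
    intro k x
    have h1 : HasDerivAt (fun x => φ (v k x)) (φ (v (k + 1) (x / σ))) (x / σ) :=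
      φ.hasFDerivAt.comp_hasDerivAt (x / σ) (hv k (x / σ))
    refine ((h1.comp x ((hasDerivAt_id x).div_const σ)).const_mul (σ ^ k)⁻¹).congr_deriv ?_
    simp only [hc]
    rw [pow_succ]
    field_simp
  have hcb : ∀ k x, |c k x| ≤ ‖φ‖ * B := by
    intro k x
    simp only [hc]
    rw [abs_mul, abs_of_pos (by positivity), inv_mul_le_iff₀ (by positivity)]
    calc _ ≤ ‖φ‖ * ‖v k (x / σ)‖ := φ.le_opNorm _
      _ ≤ ‖φ‖ * (σ ^ k * B) := by gcongr; exact hb k _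
      _ = _ := by ring
  have hlim := tendsto_sampling_real hcd hcb (σ * t)
  have hsum := (φ.hasSum hs.hasSum).comp tendsto_Icc_subtype_ne_zero
  have hlim' := (hsum.const_mul t).const_add (t * nsinc (σ * t / Real.pi) * φ (v 1 0))
  have heq := tendsto_nhds_unique hlim (hlim'.congr fun N => ?_)
  · simp only [hc, pow_zero, inv_one, one_mul, zero_div, mul_div_cancel_left₀ _ hσ.ne'] at heq
    simp only [map_add, map_smul, smul_eq_mul]
    linarith
  · simp only [Function.comp_apply]
    rw [Finset.sum_subtype_eq_sum_filter (f := fun k : ℤ => φ (nsinc (σ * t / Real.pi - k) •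
      (k * Real.pi / σ)⁻¹ • (v 0 (k * Real.pi / σ) - v 0 0))), Finset.filter_ne', Finset.mul_sum,
      Finset.mul_sum]
    congr 1
    · simp only [hc, hsinc0, zero_div, pow_one]
      field_simp
    · refine Finset.sum_congr rfl fun k _ => ?_
      simp only [hc, hsinc, map_smul, map_sub, smul_eq_mul, pow_zero, inv_one, one_mul, zero_div,
        inv_div]
      field_simp

end SamplingSeries

end BernsteinSampling

namespace BernsteinSampling

/-! ### Application to orbits of the isometry group. -/

section Orbits

variable {𝕜 E : Type*} [RCLike 𝕜] [NormedAddCommGroup E] [NormedSpace 𝕜 E]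

theorem exists_iterates_of_mem_bernsteinSpace (T : IsometryGroup 𝕜 E) {σ : ℝ} {f : E}
    (hf : f ∈ bernsteinSpace T.generator σ) :
    ∃ w : ℕ → E, w 0 = f ∧ w 1 = T.generator ⟨f, mem_domain_of_mem_bernsteinSpace hf⟩ ∧
      (∀ k, T.HasGeneratorAt (w k) (w (k + 1))) ∧ ∀ k, ‖w k‖ ≤ σ ^ k * ‖f‖ := by
  have h : ∀ k, f ∈ (ppow T.generator k).domain := fun k => (hf k).choose
  refine ⟨fun k => ppow T.generator k ⟨f, h k⟩, rfl, rfl, fun k => ?_,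
    fun k => (hf k).choose_spec⟩
  obtain ⟨h1, h2⟩ := mem_pcomp_domain.1 (h (k + 1))
  exact T.generator_spec ⟨_, h2⟩

theorem IsometryGroup.hasDerivAt_orbit [NormedSpace ℝ E] [IsScalarTower ℝ 𝕜 E]
    (T : IsometryGroup 𝕜 E) {x y : E} (h : T.HasGeneratorAt x y) (t : ℝ) :
    HasDerivAt (fun t => T t x) (T t y) t := by
  rw [hasDerivAt_iff_tendsto_slope_zero]
  refine (((T t).continuous.tendsto y).comp h).congr fun s => ?_
  rw [Function.comp_apply, T.map_add, ContinuousLinearMap.comp_apply, map_smul, map_sub,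
    RCLike.real_smul_eq_coe_smul (K := 𝕜)]

theorem nsinc_neg (x : ℝ) : nsinc (-x) = nsinc x := by simp [nsinc, Real.sinc_neg]

/-- Arbitrary `θ`, and a `G` that may depend on `t`, let one statement serve both series. -/
theorem tendstoUniformly_sum_nsinc [CompleteSpace E] {σ B : ℝ} {G : {k : ℤ // k ≠ 0} → ℝ → E}
    (hG : ∀ k t, ‖G k t‖ ≤ B) (θ : ℝ → ℝ) :
    (∀ t, Summable fun k : {k : ℤ // k ≠ 0} => ((nsinc (θ t - (k : ℤ)) : ℝ) : 𝕜) •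
      ((((k : ℤ) * Real.pi / σ)⁻¹ : ℝ) : 𝕜) • G k t) ∧
    TendstoUniformly
      (fun (s : Finset {k : ℤ // k ≠ 0}) (t : ℝ) => ∑ k ∈ s,
        ((nsinc (θ t - (k : ℤ)) : ℝ) : 𝕜) • ((((k : ℤ) * Real.pi / σ)⁻¹ : ℝ) : 𝕜) • G k t)
      (fun t => ∑' k : {k : ℤ // k ≠ 0},
        ((nsinc (θ t - (k : ℤ)) : ℝ) : 𝕜) • ((((k : ℤ) * Real.pi / σ)⁻¹ : ℝ) : 𝕜) • G k t)
      atTop := by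
  refine tendstoUniformly_sum_of_sq_bounds (A := fun k => |((k : ℤ) * Real.pi / σ)⁻¹| * B)
    (S := fun k t => |Real.sinc (Real.pi * θ t - (k : ℤ) * Real.pi)|)
    (C := ∑' m : ℤ, ((if m = 0 then 1 else 0) + 1 / (m : ℝ) ^ 2)) (fun k t => ?_) ?_
    fun s t => ?_
  · rw [norm_smul, norm_smul, RCLike.norm_ofReal, RCLike.norm_ofReal, nsinc, mul_sub,
      mul_comm Real.pi ((k : ℤ) : ℝ), mul_comm]
    gcongr
    exact hG k t
  · have h := ((Real.summable_one_div_int_pow.2 one_lt_two).mul_left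
      ((σ / Real.pi * B) ^ 2)).comp_injective
      (Subtype.val_injective (p := fun k : ℤ => k ≠ 0))
    refine h.congr fun k => ?_
    rw [Function.comp_apply, mul_pow |_|, sq_abs, inv_div]
    ring
  · simp_rw [sq_abs]
    have h := sum_sinc_sub_int_mul_pi_sq_le (Real.pi * θ t) (s.map (Function.Embedding.subtype _))
    rwa [Finset.sum_map] at h

/-- The free base point `a` yields both formulas: `a = 0` gives the first, and starting at time `t`
and moving by `-t` gives the dual one. -/
theorem IsometryGroup.apply_eq_add_tsum [NormedSpace ℝ E] [IsScalarTower ℝ 𝕜 E]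
    (T : IsometryGroup 𝕜 E) {σ : ℝ} (hσ : 0 < σ) {f : E} {w : ℕ → E}
    (hw : ∀ k, T.HasGeneratorAt (w k) (w (k + 1))) (hle : ∀ k, ‖w k‖ ≤ σ ^ k * ‖f‖) (a t : ℝ)
    (hs : Summable fun k : {k : ℤ // k ≠ 0} => ((nsinc (σ * t / Real.pi - (k : ℤ)) : ℝ) : 𝕜) •
      ((((k : ℤ) * Real.pi / σ)⁻¹ : ℝ) : 𝕜) • (T ((k : ℤ) * Real.pi / σ + a) (w 0) - T a (w 0))) :
    T (t + a) (w 0) = T a (w 0) + ((t * nsinc (σ * t / Real.pi) : ℝ) : 𝕜) • T a (w 1) +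
      (t : 𝕜) • ∑' k : {k : ℤ // k ≠ 0}, ((nsinc (σ * t / Real.pi - (k : ℤ)) : ℝ) : 𝕜) •
        ((((k : ℤ) * Real.pi / σ)⁻¹ : ℝ) : 𝕜) •
          (T ((k : ℤ) * Real.pi / σ + a) (w 0) - T a (w 0)) := by
  have hv : ∀ k x, HasDerivAt (fun x => T (x + a) (w k)) (T (x + a) (w (k + 1))) x :=
    fun k x => (T.hasDerivAt_orbit (hw k) (x + a)).comp_add_const x a
  have hb : ∀ k x, ‖T (x + a) (w k)‖ ≤ σ ^ k * ‖f‖ := fun k x => by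
    rw [T.norm_map]
    exact hle k
  have h := eq_add_tsum_sampling (v := fun k x => T (x + a) (w k)) hσ hv hb t
  simp only [zero_add, RCLike.real_smul_eq_coe_smul (K := 𝕜)] at h
  exact h hs

end Orbits

end BernsteinSampling

theorem mainTheorem5 {𝕜 E : Type*} [RCLike 𝕜] [NormedAddCommGroup E] [NormedSpace 𝕜 E]
    [CompleteSpace E] (T : BernsteinSampling.IsometryGroup 𝕜 E) (σ : ℝ) (hσ : 0 < σ) (f : E)
    (hf : f ∈ BernsteinSampling.bernsteinSpace T.generator σ) :
    (∀ t : ℝ, T t f = f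
        + ((t * BernsteinSampling.nsinc (σ * t / Real.pi) : ℝ) : 𝕜) •
            T.generator ⟨f, BernsteinSampling.mem_domain_of_mem_bernsteinSpace hf⟩
        + (t : 𝕜) • ∑' k : {k : ℤ // k ≠ 0}, T.samplingTerm σ f k t) ∧
      (∀ t : ℝ, f = T t f
        - ((t * BernsteinSampling.nsinc (σ * t / Real.pi) : ℝ) : 𝕜) •
            T t (T.generator ⟨f, BernsteinSampling.mem_domain_of_mem_bernsteinSpace hf⟩)
        - (t : 𝕜) • ∑' k : {k : ℤ // k ≠ 0}, T.dualSamplingTerm σ f k t) ∧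
      TendstoUniformly
        (fun (s : Finset {k : ℤ // k ≠ 0}) (t : ℝ) => ∑ k ∈ s, T.samplingTerm σ f k t)
        (fun t : ℝ => ∑' k : {k : ℤ // k ≠ 0}, T.samplingTerm σ f k t) Filter.atTop ∧
      TendstoUniformly
        (fun (s : Finset {k : ℤ // k ≠ 0}) (t : ℝ) => ∑ k ∈ s, T.dualSamplingTerm σ f k t)
        (fun t : ℝ => ∑' k : {k : ℤ // k ≠ 0}, T.dualSamplingTerm σ f k t) Filter.atTop := by
  -- Real functionals already separate points, so the real and complex cases are treated together.
  let _ : NormedSpace ℝ E := NormedSpace.restrictScalars ℝ 𝕜 E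
  have : IsScalarTower ℝ 𝕜 E := IsScalarTower.of_algebraMap_smul fun _ _ => rfl
  obtain ⟨w, hw0, hw1, hw, hle⟩ := BernsteinSampling.exists_iterates_of_mem_bernsteinSpace T hf
  have hnorm : ∀ x t, ‖T x f - T t f‖ ≤ 2 * ‖f‖ := fun x t => by
    refine (norm_sub_le _ _).trans_eq ?_
    rw [T.norm_map, T.norm_map, two_mul]
  have hT0 : ∀ x, T 0 x = x := fun x => by rw [T.map_zero]; rfl
  have h1 := BernsteinSampling.tendstoUniformly_sum_nsinc (𝕜 := 𝕜) (σ := σ) (B := 2 * ‖f‖)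
    (G := fun k _ => T ((k : ℤ) * Real.pi / σ) f - f)
    (fun k t => by simpa only [hT0] using hnorm ((k : ℤ) * Real.pi / σ) 0)
    fun t => σ * t / Real.pi
  have h2 := BernsteinSampling.tendstoUniformly_sum_nsinc (𝕜 := 𝕜) (σ := σ) (B := 2 * ‖f‖)
    (G := fun k t => T ((k : ℤ) * Real.pi / σ + t) f - T t f)
    (fun k t => hnorm _ _) fun t => σ * -t / Real.pi
  have hdual : ∀ (k : ℤ) (t : ℝ), BernsteinSampling.nsinc (σ * -t / Real.pi - k) =
      BernsteinSampling.nsinc (σ * t / Real.pi + k) := fun k t => by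
    rw [← BernsteinSampling.nsinc_neg]
    congr 1
    ring
  have hdual0 : ∀ t : ℝ, BernsteinSampling.nsinc (σ * -t / Real.pi) =
      BernsteinSampling.nsinc (σ * t / Real.pi) := fun t => by simpa using hdual 0 t
  refine ⟨fun t => ?_, fun t => ?_, h1.2, ?_⟩
  · have h := T.apply_eq_add_tsum hσ hw hle 0 t
      (by simpa only [add_zero, hT0, hw0] using h1.1 t)
    simp only [add_zero, hT0, hw0, hw1] at h
    exact h
  · have h := T.apply_eq_add_tsum hσ hw hle t (-t) (by simpa only [hw0] using h2.1 t)
    simp only [neg_add_cancel, hT0, hw0, hw1, hdual, hdual0, neg_mul, RCLike.ofReal_neg, neg_smul,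
      ← sub_eq_add_neg] at h
    exact h
  · simpa only [hdual] using! h2.2
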